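/- Throughout, "space" means separable metrizable topological space and "countable" means at most countable. A space $X$ is *countable dense homogeneous* (CDH) if for every pair $(A,B)$ of countable dense subsets of $X$ there is a homeomorphism $h : X \to X$ with $h[A]=B$. A space is *zero-dimensional* if its clopen subsets form a base, and *Borel* if it is homeomorphic to a Borel subspace of some Polish space. **Corollary.** Let $I$ be a countable set and, for every $i\in I$, let $X_i$ be a zero-dimensional Borel CDH space. Then the product $\prod_{i\in I}X_i$ (with the product topology) is CDH. -/

import Mathlib

open Set Topology TopologicalSpace

universe u

/-- A topological space is countable dense homogeneous if any two of its (at most) countable dense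
subsets are mapped onto each other by a self-homeomorphism of the space. -/
def IsCDH (X : Type u) [TopologicalSpace X] : Prop :=
  ∀ A B : Set X, A.Countable → Dense A → B.Countable → Dense B → ∃ h : X ≃ₜ X, h '' A = B

/-- A topological space is zero-dimensional if its clopen subsets form a base. -/
def IsZeroDimensional (X : Type u) [TopologicalSpace X] : Prop :=
  IsTopologicalBasis {s : Set X | IsClopen s}

/-- A space is (absolute) Borel if it is homeomorphic to a Borel subspace of some Polish space. -/
def IsAbsoluteBorel (X : Type u) [TopologicalSpace X] : Prop :=
  ∃ (Y : Type u) (_ : TopologicalSpace Y) (_ : PolishSpace Y) (f : X → Y),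
    IsEmbedding f ∧ @MeasurableSet Y (borel Y) (range f)

/-!
The proof has two halves. The first shows that every countable dense homogeneous Borel space `X` is
Polish. If `X` is meagre in itself, it has a countable dense `Gδ` subset, so by homogeneity every
countable subset is `Gδ`; a Borel space with this property is countable, since otherwise it contains
a Cantor set, and a countable meagre space is not homogeneous because a point can be deleted from
it. Applied to the largest meagre open subset, this shows that `X` has no nonempty meagre open
subset (`IsCDH.not_isMeagre_of_isOpen`). The Baire property then gives a dense Polish subspace, and
homogeneity moves it so that it contains any given countable set. For a coanalytic set this implies
being `Gδ` in the ambient Polish space (`isGδ_of_forall_countable_subset`): if a continuous image of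
`ℕ → ℕ` fills the complement and cannot be separated from `X` by a countable union of closed sets,
then a closed part of `ℕ → ℕ` has the property that the images of its relatively open pieces
accumulate at points of `X`. Countably many such points lie in a `Gδ` subset of `X`, whose preimage
in that part is comeagre, although it must be empty.

The second half characterizes countable dense homogeneity of zero-dimensional Polish spaces by a
condition that products visibly preserve: the isolated points form a closed set, and so do the
points of local compactness (`IsTame`). Necessity holds because a set invariant under all
homeomorphisms of a countable dense homogeneous space is closed (`IsCDH.isClosed_of_invariant`).
Conversely, such a space is partitioned into clopen pieces that are points, crowded compact spaces,
or nowhere locally compact spaces. A piece of one of the last two kinds, together with a countable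
dense subset, is homeomorphic to the Cantor or Baire space with the sequences that are eventually
constant with a fixed value (`exists_homeomorph_of_splitting`), so any two countable dense subsets
of it are exchanged by a homeomorphism. In a product, a point is isolated if and only if its
coordinates are and all but finitely many factors have at most one point, and similarly for local
compactness and compact factors; hence tameness passes to products.
-/

/-! ### Gδ subsets of Polish spaces -/

theorem IsGδ.polishSpace {Y : Type*} [TopologicalSpace Y] [PolishSpace Y] {s : Set Y}
    (hs : IsGδ s) : PolishSpace s := by
  obtain ⟨O, hO, rfl⟩ := isGδ_iff_eq_iInter_nat.1 hs
  have : ∀ n, PolishSpace (O n) := fun n => (hO n).polishSpace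
  let φ : (⋂ n, O n : Set Y) → ∀ n, O n := fun x n => ⟨x, mem_iInter.1 x.2 n⟩
  have hφ : Continuous φ := by fun_prop
  have hemb : IsEmbedding φ := by
    refine IsEmbedding.of_comp hφ (g := fun z : ∀ n, O n => (z 0 : Y)) (by fun_prop) ?_
    exact IsEmbedding.subtypeVal
  have hrange : range φ = {z | ∀ n, (z n : Y) = z 0} := by
    ext z
    constructor
    · rintro ⟨x, rfl⟩ n
      rfl
    · intro hz
      refine ⟨⟨z 0, mem_iInter.2 fun n => hz n ▸ (z n).2⟩, ?_⟩
      ext n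
      exact (hz n).symm
  have hclosed : IsClosed (range φ) := by
    rw [hrange, ofPred_forall]
    exact isClosed_iInter fun n => isClosed_eq (by fun_prop) (by fun_prop)
  exact IsClosedEmbedding.polishSpace ⟨hemb, hclosed⟩

/-- A completely metrizable subspace of a metrizable space is a `Gδ` set: its points are those of
its closure at which the trace of the neighborhood filter is Cauchy for a complete metric. -/
theorem Topology.IsEmbedding.isGδ_range {X Y : Type*} [TopologicalSpace X] [TopologicalSpace Y]
    [IsCompletelyMetrizableSpace X] [MetrizableSpace Y] {f : X → Y} (hf : IsEmbedding f) :
    IsGδ (range f) := by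
  let := upgradeIsCompletelyMetrizable X
  let := metrizableSpaceMetric Y
  let O : ℕ → Set Y := fun n =>
    ⋃₀ {V | IsOpen V ∧ ∀ x ∈ f ⁻¹' V, ∀ y ∈ f ⁻¹' V, dist x y < 1 / (n + 1 : ℝ)}
  have hO : ∀ n, IsOpen (O n) := fun n => isOpen_sUnion fun V hV => hV.1
  have key : range f = closure (range f) ∩ ⋂ n, O n := by
    apply Subset.antisymm
    · refine subset_inter subset_closure ?_
      rintro _ ⟨x, rfl⟩
      refine mem_iInter.2 fun n => ?_
      have hpos : (0 : ℝ) < 1 / (n + 1 : ℝ) / 2 := by positivity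
      obtain ⟨V, hV, hVx⟩ := hf.isOpen_iff.1 (Metric.isOpen_ball (x := x) (ε := 1 / (n + 1 : ℝ) / 2))
      refine ⟨V, ⟨hV, fun y hy z hz => ?_⟩, ?_⟩
      · rw [hVx, Metric.mem_ball] at hy hz
        have := dist_triangle_right y z x
        linarith
      · have : x ∈ f ⁻¹' V := hVx ▸ Metric.mem_ball_self hpos
        exact this
    · rintro y ⟨hy, hyO⟩
      have hne : (Filter.comap f (𝓝 y)).NeBot := by
        rw [Filter.comap_neBot_iff]
        intro t ht
        obtain ⟨_, hz, x, rfl⟩ := mem_closure_iff_nhds.1 hy t ht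
        exact ⟨x, hz⟩
      have hcauchy : Cauchy (Filter.comap f (𝓝 y)) := by
        refine Metric.cauchy_iff.2 ⟨hne, fun ε hε => ?_⟩
        obtain ⟨n, hn⟩ := exists_nat_one_div_lt hε
        obtain ⟨V, ⟨hV, hVd⟩, hyV⟩ := mem_iInter.1 hyO n
        exact ⟨f ⁻¹' V, Filter.preimage_mem_comap (hV.mem_nhds hyV),
          fun a ha b hb => (hVd a ha b hb).trans hn⟩
      obtain ⟨x, hx⟩ := CompleteSpace.complete hcauchy
      have h1 : Filter.Tendsto f (Filter.comap f (𝓝 y)) (𝓝 (f x)) :=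
        (hf.continuous.tendsto x).mono_left hx
      exact ⟨x, tendsto_nhds_unique h1 Filter.tendsto_comap⟩
  rw [key]
  exact isClosed_closure.isGδ.inter (.iInter_of_isOpen hO)

/-- A coanalytic subset of a Polish space is `Gδ` as soon as each of its countable subsets can be
enclosed in a `Gδ` set that it contains. This replaces Hurewicz' theorem on closed copies of the
rationals. -/
theorem isGδ_of_forall_countable_subset {Y : Type*} [TopologicalSpace Y] [PolishSpace Y]
    {X : Set Y} (hX : MeasureTheory.AnalyticSet Xᶜ)
    (h : ∀ Q ⊆ X, Q.Countable → ∃ G, IsGδ G ∧ Q ⊆ G ∧ G ⊆ X) : IsGδ X := by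
  rw [MeasureTheory.AnalyticSet] at hX
  obtain hX | ⟨f, hf, hfX⟩ := hX
  · rw [compl_empty_iff.1 hX]
    exact .univ
  -- `small N` says that the image of `N` can be separated from `X` by an `Fσ` set.
  let small : Set (ℕ → ℕ) → Prop := fun N => ∃ H : Set Y, IsGδ H ∧ X ⊆ H ∧ ∀ z ∈ N, f z ∉ H
  have small_mono : ∀ {N N'}, N ⊆ N' → small N' → small N := fun hN ⟨H, h1, h2, h3⟩ =>
    ⟨H, h1, h2, fun z hz => h3 z (hN hz)⟩
  have small_sUnion : ∀ S : Set (Set (ℕ → ℕ)), S.Countable → (∀ N ∈ S, small N) →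
      small (⋃₀ S) := by
    intro S hS hN
    choose! H h1 h2 h3 using hN
    refine ⟨⋂ N ∈ S, H N, .biInter hS h1, subset_iInter₂ h2, ?_⟩
    rintro z ⟨N, hNS, hz⟩ hz'
    exact h3 N hNS z hz (mem_iInter₂.1 hz' N hNS)
  let 𝒲 : Set (Set (ℕ → ℕ)) := {N | IsOpen N ∧ small N}
  let T : Set (ℕ → ℕ) := (⋃₀ 𝒲)ᶜ
  have hW : small (⋃₀ 𝒲) := by
    obtain ⟨S, hS, hSW, hSU⟩ := isOpen_sUnion_countable 𝒲 fun N hN => hN.1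
    rw [← hSU]
    exact small_sUnion S hS fun N hN => (hSW hN).2
  have hTclosed : IsClosed T := (isOpen_sUnion fun N hN => hN.1).isClosed_compl
  by_cases hT : T.Nonempty
  swap
  · -- The whole space is small.
    obtain ⟨H, h1, h2, h3⟩ := hW
    have hHX : H = X := by
      refine Subset.antisymm (fun y hy => ?_) h2
      by_contra hyX
      obtain ⟨z, rfl⟩ : y ∈ range f := hfX ▸ hyX
      refine h3 z ?_ hy
      by_contra hz
      exact hT ⟨z, hz⟩
    exact hHX ▸ h1
  exfalso
  have hacc : ∀ N, IsOpen N → (N ∩ T).Nonempty → (closure (f '' (N ∩ T)) ∩ X).Nonempty := by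
    intro N hN hNT
    by_contra hempty
    have hNTsmall : small (N ∩ T) :=
      ⟨(closure (f '' (N ∩ T)))ᶜ, isClosed_closure.isOpen_compl.isGδ,
        fun y hy hy' => hempty ⟨y, hy', hy⟩,
        fun z hz hz' => hz' (subset_closure (mem_image_of_mem f hz))⟩
    have hNsmall : small N := by
      refine small_mono (N' := ⋃₀ {N ∩ T, ⋃₀ 𝒲}) ?_ (small_sUnion _ (by simp) ?_)
      · intro z hz
        rw [sUnion_pair]
        by_cases hzT : z ∈ T
        · exact Or.inl ⟨hz, hzT⟩
        · exact Or.inr (not_not.1 hzT)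
      · rintro _ (rfl | rfl)
        · exact hNTsmall
        · exact hW
    obtain ⟨z, hzN, hzT⟩ := hNT
    exact hzT ⟨N, ⟨hN, hNsmall⟩, hzN⟩
  have : Nonempty Y := ⟨f 0⟩
  choose! x hx using hacc
  let ℬ := {N ∈ countableBasis (ℕ → ℕ) | (N ∩ T).Nonempty}
  have hℬ : ∀ N ∈ ℬ, x N ∈ closure (f '' (N ∩ T)) ∩ X := fun N hN =>
    hx N (isOpen_of_mem_countableBasis hN.1) hN.2
  obtain ⟨G, hG, hQG, hGX⟩ := h (x '' ℬ) (by rintro _ ⟨N, hN, rfl⟩; exact (hℬ N hN).2)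
    (((countable_countableBasis _).mono (sep_subset _ _)).image x)
  obtain ⟨O, hO, rfl⟩ := isGδ_iff_eq_iInter_nat.1 hG
  have : PolishSpace T := hTclosed.polishSpace
  have : Nonempty T := hT.to_subtype
  have hfT : Continuous fun z : T => f z := by fun_prop
  have hdense : Dense (⋂ n, (fun z : T => f z) ⁻¹' O n) := by
    refine dense_iInter_of_isOpen (fun n => (hO n).preimage hfT) fun n => ?_
    refine dense_iff_inter_open.2 ?_
    rintro U hU ⟨z, hz⟩
    obtain ⟨U', hU', rfl⟩ := isOpen_induced_iff.1 hU
    obtain ⟨N, hN, hzN, hNU⟩ := (isBasis_countableBasis (ℕ → ℕ)).exists_subset_of_mem_open hz hU'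
    have hNℬ : N ∈ ℬ := ⟨hN, z, hzN, z.2⟩
    have hxO : x N ∈ O n := mem_iInter.1 (hQG (mem_image_of_mem x hNℬ)) n
    obtain ⟨_, hw, w, ⟨hwN, hwT⟩, rfl⟩ := mem_closure_iff.1 (hℬ N hNℬ).1 _ (hO n) hxO
    exact ⟨⟨w, hwT⟩, hNU hwN, hw⟩
  obtain ⟨z, hz⟩ := hdense.nonempty
  have hzX : f z ∈ X := hGX (mem_iInter.2 fun n => mem_iInter.1 hz n)
  have : f z ∈ Xᶜ := hfX ▸ mem_range_self _
  exact this hzX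

/-! ### Countable dense homogeneous Borel spaces are Polish -/

/-- If `X` is the union of an increasing sequence of closed nowhere dense sets `F k`, then picking
`d k` in the `k`-th basic open set outside `F k` gives a dense set meeting every `F k` in a finite
set. -/
theorem exists_countable_dense_isGδ_of_isMeagre_univ {X : Type*} [TopologicalSpace X] [T1Space X]
    [SecondCountableTopology X] (h : IsMeagre (univ : Set X)) :
    ∃ D : Set X, D.Countable ∧ Dense D ∧ IsGδ D := by
  rcases isEmpty_or_nonempty X with hX | hX
  · exact ⟨∅, countable_empty, fun x => hX.elim x, .empty⟩
  rw [IsMeagre, compl_univ, mem_residual_iff] at h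
  obtain ⟨S, hSo, hSd, hS, hSe⟩ := h
  have hSne : S.Nonempty := by
    rw [nonempty_iff_ne_empty]
    rintro rfl
    obtain ⟨x⟩ := hX
    exact hSe (show x ∈ ⋂₀ ∅ by simp)
  obtain ⟨g, rfl⟩ := hS.exists_eq_range hSne
  have hBne : (countableBasis X).Nonempty := by
    obtain ⟨x⟩ := hX
    obtain ⟨U, hU, -⟩ := (isBasis_countableBasis X).exists_subset_of_mem_open
      (mem_univ x) isOpen_univ
    exact ⟨U, hU⟩
  obtain ⟨U, hU⟩ := (countable_countableBasis X).exists_eq_range hBne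
  have hUb : ∀ k, U k ∈ countableBasis X := fun k => hU ▸ mem_range_self k
  have hV : ∀ k, (U k ∩ ⋂₀ (g '' Iic k)).Nonempty := by
    intro k
    have : Dense (⋂₀ (g '' Iic k)) := ((finite_Iic k).image g).dense_sInter
      (by rintro _ ⟨n, -, rfl⟩; exact hSo _ (mem_range_self n))
      (by rintro _ ⟨n, -, rfl⟩; exact hSd _ (mem_range_self n))
    exact this.inter_open_nonempty _ (isOpen_of_mem_countableBasis (hUb k))
      (nonempty_of_mem_countableBasis (hUb k))
  choose d hdU hdg using hV
  refine ⟨range d, countable_range d, ?_, ?_⟩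
  · refine (isBasis_countableBasis X).dense_iff.2 fun o ho _ => ?_
    obtain ⟨k, rfl⟩ : o ∈ range U := hU ▸ ho
    exact ⟨d k, hdU k, mem_range_self k⟩
  · have : range d = ⋂ n, (g n ∪ d '' Iio n) := by
      apply Subset.antisymm
      · rintro _ ⟨k, rfl⟩
        refine mem_iInter.2 fun n => ?_
        rcases lt_or_ge k n with hk | hk
        · exact Or.inr ⟨k, hk, rfl⟩
        · exact Or.inl (hdg k _ ⟨n, hk, rfl⟩)
      · intro x hx
        by_contra hxd
        refine hSe (a := x) ?_
        rintro _ ⟨n, rfl⟩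
        rcases mem_iInter.1 hx n with h | ⟨k, -, rfl⟩
        · exact h
        · exact (hxd (mem_range_self k)).elim
    rw [this]
    refine .iInter fun n => (hSo _ (mem_range_self n)).isGδ.union ?_
    rw [← biUnion_of_singleton (d '' Iio n)]
    exact .biUnion ((finite_Iio n).image d) fun x _ => .singleton x

theorem IsCDH.isGδ_of_countable {X : Type*} [TopologicalSpace X] [T1Space X] (h : IsCDH X)
    {D : Set X} (hDc : D.Countable) (hDd : Dense D) (hD : IsGδ D) {Q : Set X}
    (hQ : Q.Countable) : IsGδ Q := by
  obtain ⟨e, he⟩ := h D (Q ∪ D) hDc hDd (hQ.union hDc) (hDd.mono subset_union_right)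
  have h1 : IsGδ (Q ∪ D) := by
    rw [← he, e.image_eq_preimage_symm]
    exact hD.preimage e.symm.continuous
  have h2 : Q = (Q ∪ D) ∩ (D \ Q)ᶜ := by
    ext x
    simp only [mem_inter_iff, mem_union, mem_compl_iff, mem_sdiff]
    tauto
  rw [h2]
  exact h1.inter (hDc.mono sdiff_subset).isGδ_compl

/-- An uncountable Borel space contains a copy of the Cantor set, in which a countable dense set
is not `Gδ`. -/
theorem IsAbsoluteBorel.exists_countable_not_isGδ {X : Type*} [TopologicalSpace X]
    (hX : IsAbsoluteBorel X) (hunc : ¬ Countable X) : ∃ Q : Set X, Q.Countable ∧ ¬ IsGδ Q := by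
  obtain ⟨Y, tY, _, f, hf, hfm⟩ := hX
  have hmeas : @MeasurableSet Y (borel Y) (range f) := hfm
  let _ : MeasurableSpace Y := borel Y
  have _ : BorelSpace Y := ⟨rfl⟩
  have hunc' : ¬ (range f).Countable := fun hc => hunc <| by
    have := hc.to_subtype
    exact (Equiv.ofInjective f hf.injective).countable_iff.2 this
  obtain ⟨c, hcr, hcc, hci⟩ : ∃ c : (ℕ → Bool) → Y,
      range c ⊆ range f ∧ Continuous c ∧ Function.Injective c := by
    obtain ⟨t, htle, htP, htc, -⟩ := hmeas.isClopenable
    obtain ⟨c, hcr, hcc, hci⟩ :=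
      @IsClosed.exists_nat_bool_injection_of_not_countable Y t htP _ htc hunc'
    exact ⟨c, hcr, continuous_le_rng htle hcc, hci⟩
  choose g hg using fun z => hcr (mem_range_self z)
  have hgc : Continuous g := hf.continuous_iff.2 (by simpa [Function.comp_def, hg] using hcc)
  have hgi : Function.Injective g := fun a b hab => hci (by rw [← hg, ← hg, hab])
  obtain ⟨Q, hQ, hQd⟩ := exists_countable_dense (ℕ → Bool)
  refine ⟨g '' Q, hQ.image g, fun hG => ?_⟩
  have h1 : IsGδ Q := by
    have := hG.preimage hgc
    rwa [hgi.preimage_image] at this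
  have hiso : ∀ z : ℕ → Bool, Dense ({z}ᶜ : Set (ℕ → Bool)) := by
    intro z
    refine dense_compl_singleton_iff_not_open.2 fun ho => ?_
    have hu : Filter.Tendsto (fun n => Function.update z n (!z n)) Filter.atTop (𝓝 z) := by
      refine tendsto_pi_nhds.2 fun k => ?_
      refine tendsto_const_nhds.congr' ?_
      filter_upwards [Filter.eventually_gt_atTop k] with n hn
      rw [Function.update_of_ne hn.ne]
    obtain ⟨n, hn⟩ := (hu.eventually (ho.mem_nhds rfl)).exists
    have := congrFun (show Function.update z n (!z n) = z from hn) n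
    simp at this
  have h2 : Dense (Qᶜ : Set (ℕ → Bool)) := by
    have : Qᶜ = ⋂ z ∈ Q, ({z}ᶜ : Set (ℕ → Bool)) := by
      ext x
      simp only [mem_compl_iff, mem_iInter, mem_singleton_iff]
      exact ⟨fun hx z hz hxz => hx (hxz ▸ hz), fun hx hxQ => hx x hxQ rfl⟩
    rw [this]
    exact dense_biInter_of_isOpen (fun z _ => isOpen_compl_singleton) hQ fun z _ => hiso z
  have h3 := (hQd.inter_of_Gδ h1 hQ.isGδ_compl h2).nonempty
  simp at h3

theorem IsCDH.not_isMeagre_univ {X : Type*} [TopologicalSpace X] [T1Space X] [Nonempty X]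
    [SecondCountableTopology X] (h : IsCDH X) (hX : IsAbsoluteBorel X) :
    ¬ IsMeagre (univ : Set X) := by
  intro hm
  obtain ⟨D, hDc, hDd, hD⟩ := exists_countable_dense_isGδ_of_isMeagre_univ hm
  by_cases hc : Countable X
  · obtain ⟨p⟩ := ‹Nonempty X›
    -- As `X` is meagre, `p` is not isolated, and no homeomorphism maps `X` onto `X \ {p}`.
    have hp : Dense ({p}ᶜ : Set X) := by
      refine dense_compl_singleton_iff_not_open.2 fun ho => ?_
      rw [IsMeagre, compl_univ, mem_residual_iff] at hm
      obtain ⟨S, hSo, hSd, hS, hSe⟩ := hm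
      refine hSe (a := p) fun s hs => ?_
      obtain ⟨q, hq, hqs⟩ := (hSd s hs).inter_open_nonempty _ ho ⟨p, rfl⟩
      exact (mem_singleton_iff.1 hq) ▸ hqs
    obtain ⟨e, he⟩ := h univ {p}ᶜ (to_countable _) dense_univ (to_countable _) hp
    rw [image_univ, e.range_coe] at he
    have : p ∈ ({p}ᶜ : Set X) := he ▸ mem_univ p
    exact this rfl
  · obtain ⟨Q, hQ, hQG⟩ := hX.exists_countable_not_isGδ hc
    exact hQG (h.isGδ_of_countable hDc hDd hD hQ)

theorem IsAbsoluteBorel.subtype_of_isOpen {X : Type*} [TopologicalSpace X]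
    (hX : IsAbsoluteBorel X) {M : Set X} (hM : IsOpen M) : IsAbsoluteBorel M := by
  obtain ⟨Y, tY, hY, f, hf, hfm⟩ := hX
  refine ⟨Y, tY, hY, f ∘ Subtype.val, hf.comp .subtypeVal, ?_⟩
  obtain ⟨O, hO, rfl⟩ := hf.isOpen_iff.1 hM
  let _ : MeasurableSpace Y := borel Y
  have _ : BorelSpace Y := ⟨rfl⟩
  rw [range_comp, Subtype.range_coe, image_preimage_eq_inter_range]
  exact hO.measurableSet.inter hfm

/-- A subspace invariant under all homeomorphisms of the whole space inherits countable dense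
homogeneity: two countable dense subsets of it are extended by the same set outside its closure. -/
theorem IsCDH.subtype_of_invariant {X : Type*} [TopologicalSpace X] [SecondCountableTopology X]
    (h : IsCDH X) {M : Set X} (hinv : ∀ (e : X ≃ₜ X), ∀ x ∈ M, e x ∈ M) :
    IsCDH M := by
  intro A B hA hAd hB hBd
  obtain ⟨D, hDc, hDd⟩ := exists_countable_dense X
  let E := D \ closure M
  have hdense : ∀ A : Set M, Dense A → Dense (Subtype.val '' A ∪ E) := by
    intro A hA
    refine dense_iff_inter_open.2 fun U hU hUne => ?_
    by_cases hUM : (U ∩ M).Nonempty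
    · obtain ⟨x, hxU, hxM⟩ := hUM
      obtain ⟨y, hyU, hyA⟩ := hA.inter_open_nonempty (Subtype.val ⁻¹' U)
        (hU.preimage continuous_subtype_val) ⟨⟨x, hxM⟩, hxU⟩
      exact ⟨y, hyU, Or.inl ⟨y, hyA, rfl⟩⟩
    · have hUM' : U ∩ closure M = ∅ := by
        have : Disjoint U M := disjoint_iff_inter_eq_empty.2 (not_nonempty_iff_eq_empty.1 hUM)
        exact (this.closure_right hU).inter_eq
      obtain ⟨x, hxU, hxD⟩ := hDd.inter_open_nonempty U hU hUne
      exact ⟨x, hxU, Or.inr ⟨hxD, fun hx => notMem_empty x (hUM' ▸ ⟨hxU, hx⟩)⟩⟩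
  have htrace : ∀ (A : Set M) (x : M), (x : X) ∈ Subtype.val '' A ∪ E ↔ x ∈ A := by
    intro A x
    constructor
    · rintro (⟨y, hy, hyx⟩ | hx)
      · exact Subtype.ext hyx ▸ hy
      · exact (hx.2 (subset_closure x.2)).elim
    · exact fun hx => Or.inl ⟨x, hx, rfl⟩
  have hE : E.Countable := hDc.mono sdiff_subset
  obtain ⟨e, he⟩ := h _ _ ((hA.image _).union hE) (hdense A hAd) ((hB.image _).union hE)
    (hdense B hBd)
  have hiff : ∀ x, x ∈ M ↔ e x ∈ M := fun x =>
    ⟨hinv e x, fun hx => by simpa using hinv e.symm _ hx⟩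
  refine ⟨e.subtype hiff, ?_⟩
  rw [Homeomorph.image_eq_preimage_symm]
  ext x
  rw [mem_preimage, ← htrace A, ← htrace B x, ← he, e.image_eq_preimage_symm, mem_preimage]
  rfl

theorem IsCDH.not_isMeagre_of_isOpen {X : Type*} [TopologicalSpace X] [T1Space X]
    [SecondCountableTopology X] (h : IsCDH X) (hX : IsAbsoluteBorel X) {U : Set X}
    (hU : IsOpen U) (hne : U.Nonempty) : ¬ IsMeagre U := by
  intro hUm
  let 𝒮 : Set (Set X) := {V | IsOpen V ∧ IsMeagre V}
  let M : Set X := ⋃₀ 𝒮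
  have hMo : IsOpen M := isOpen_sUnion fun V hV => hV.1
  have hMm : IsMeagre M := by
    obtain ⟨S, hS, hSW, hSU⟩ := isOpen_sUnion_countable 𝒮 fun V hV => hV.1
    have := hS.to_subtype
    rw [show M = ⋃₀ S from hSU.symm, sUnion_eq_iUnion]
    exact isMeagre_iUnion fun V => (hSW V.2).2
  have hinv : ∀ (e : X ≃ₜ X), ∀ x ∈ M, e x ∈ M := by
    rintro e x ⟨V, ⟨hVo, hVm⟩, hx⟩
    refine ⟨e.symm ⁻¹' V, ⟨hVo.preimage e.symm.continuous,
      hVm.preimage_of_isOpenMap e.symm.continuous e.symm.isOpenMap⟩, ?_⟩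
    simpa using hx
  have hMne : Nonempty M := by
    obtain ⟨x, hx⟩ := hne
    exact ⟨x, U, ⟨hU, hUm⟩, hx⟩
  refine (h.subtype_of_invariant hinv).not_isMeagre_univ (hX.subtype_of_isOpen hMo) ?_
  have := hMm.preimage_of_isOpenMap continuous_subtype_val hMo.isOpenMap_subtype_val
  rwa [Subtype.coe_preimage_self] at this

theorem IsAbsoluteBorel.exists_denseRange {X : Type u} [TopologicalSpace X]
    (hX : IsAbsoluteBorel X) :
    ∃ (Y : Type u) (_ : TopologicalSpace Y) (_ : PolishSpace Y) (f : X → Y),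
      IsEmbedding f ∧ DenseRange f ∧ @MeasurableSet Y (borel Y) (range f) := by
  obtain ⟨Y, tY, hY, f, hf, hfm⟩ := hX
  let g : X → closure (range f) := fun x => ⟨f x, subset_closure (mem_range_self x)⟩
  have hfg : f = Subtype.val ∘ g := rfl
  have hgr : range g = Subtype.val ⁻¹' range f := by
    ext y
    exact ⟨by rintro ⟨x, rfl⟩; exact ⟨x, rfl⟩, by rintro ⟨x, hx⟩; exact ⟨x, Subtype.ext hx⟩⟩
  refine ⟨↥(closure (range f)), inferInstance, isClosed_closure.polishSpace, g,
    IsEmbedding.of_comp (by fun_prop) continuous_subtype_val hf, ?_, ?_⟩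
  · refine IsInducing.subtypeVal.dense_iff.2 fun y => ?_
    rw [← range_comp, ← hfg]
    exact y.2
  · rw [hgr]
    borelize Y
    let _ : MeasurableSpace ↥(closure (range f)) := borel _
    have _ : BorelSpace ↥(closure (range f)) := ⟨rfl⟩
    have hval : Continuous ((↑) : ↥(closure (range f)) → Y) := continuous_subtype_val
    exact hval.measurable hfm

/-- A Borel space without nonempty meagre open sets is comeagre in the Polish space of which it is a
dense subspace, by the Baire property of Borel sets. -/
theorem Topology.IsEmbedding.range_mem_residual {X Y : Type*} [TopologicalSpace X] [TopologicalSpace Y]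
    {f : X → Y} (hf : IsEmbedding f) (hd : DenseRange f)
    (hm : @MeasurableSet Y (borel Y) (range f))
    (hX : ∀ U : Set X, IsOpen U → U.Nonempty → ¬ IsMeagre U) : range f ∈ residual Y := by
  let _ : MeasurableSpace Y := borel Y
  have _ : BorelSpace Y := ⟨rfl⟩
  obtain ⟨U, hU, hUf⟩ := MeasurableSet.residualEq_isOpen (show MeasurableSet (range f) from hm)
  have hpre : ∀ R ∈ residual Y, f ⁻¹' R ∈ residual X := by
    intro R hR
    obtain ⟨S, hSo, hSd, hS, hSR⟩ := mem_residual_iff.1 hR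
    refine Filter.mem_of_superset ((countable_sInter_mem (hS.image (preimage f))).2 ?_) ?_
    · rintro _ ⟨O, hO, rfl⟩
      refine residual_of_dense_open ((hSo O hO).preimage hf.continuous) ?_
      refine dense_iff_inter_open.2 fun W hW hWne => ?_
      obtain ⟨W', hW', rfl⟩ := hf.isOpen_iff.1 hW
      obtain ⟨x, hx⟩ := hWne
      obtain ⟨y, hy⟩ := (hSd O hO).inter_open_nonempty W' hW' ⟨f x, hx⟩
      obtain ⟨x', hx'⟩ := hd.exists_mem_open (hW'.inter (hSo O hO)) ⟨y, hy⟩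
      exact ⟨x', hx'⟩
    · intro x hx
      exact hSR fun O hO => hx _ ⟨O, hO, rfl⟩
  have hUd : Dense U := by
    by_contra hUd
    obtain ⟨x, hx⟩ := hd.exists_mem_open isClosed_closure.isOpen_compl
      (nonempty_compl.2 fun h => hUd (dense_iff_closure_eq.2 h))
    refine hX (f ⁻¹' (closure U)ᶜ) (isClosed_closure.isOpen_compl.preimage hf.continuous)
      ⟨x, hx⟩ ?_
    refine Filter.mem_of_superset (hpre _ hUf) fun z hz hz' => ?_
    have h1 : f z ∈ U := by
      have : (f z ∈ range f) = (f z ∈ U) := hz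
      exact this ▸ mem_range_self z
    exact hz' (subset_closure h1)
  filter_upwards [hUf, residual_of_dense_open hU hUd] with y hy hyU
  have : (y ∈ range f) = (y ∈ U) := hy
  exact this ▸ hyU

theorem IsCDH.polishSpace {X : Type*} [TopologicalSpace X] [SeparableSpace X] [MetrizableSpace X]
    (h : IsCDH X) (hX : IsAbsoluteBorel X) : PolishSpace X := by
  have : SecondCountableTopology X := by
    let := metrizableSpaceMetric X
    exact UniformSpace.secondCountable_of_separable X
  obtain ⟨Y, tY, hY, f, hf, hd, hm⟩ := hX.exists_denseRange
  obtain ⟨t, htf, ht, htd⟩ := mem_residual.1 (hf.range_mem_residual hd hm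
    fun U hU hne => h.not_isMeagre_of_isOpen hX hU hne)
  obtain ⟨D, hDt, hDc, hDd⟩ := htd.exists_countable_dense_subset
  have hDX : Dense (f ⁻¹' D) := by
    refine hf.isInducing.dense_iff.2 fun x => ?_
    rw [image_preimage_eq_of_subset (hDt.trans htf)]
    exact hDd _
  have hDXc : (f ⁻¹' D).Countable := hDc.preimage_of_injOn hf.injective.injOn
  have htP : PolishSpace (f ⁻¹' t) := by
    have := ht.polishSpace
    refine IsClosedEmbedding.polishSpace (f := t.restrictPreimage f)
      ⟨hf.restrictPreimage t, ?_⟩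
    have : range (t.restrictPreimage f) = univ := by
      refine range_eq_univ.2 fun y => ?_
      obtain ⟨x, hx⟩ := htf y.2
      exact ⟨⟨x, show f x ∈ t from hx ▸ y.2⟩, Subtype.ext hx⟩
    rw [this]
    exact isClosed_univ
  have hGδ : IsGδ (range f) := by
    refine isGδ_of_forall_countable_subset ?_ fun Q hQf hQ => ?_
    · let _ : MeasurableSpace Y := borel Y
      have _ : BorelSpace Y := ⟨rfl⟩
      exact (MeasurableSet.compl hm).analyticSet
    · -- A homeomorphism moves the dense subset of the Polish subspace onto a set containing `Q`.
      have hQX : (f ⁻¹' Q).Countable := hQ.preimage_of_injOn hf.injective.injOn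
      obtain ⟨e, he⟩ := h (f ⁻¹' D) (f ⁻¹' Q ∪ f ⁻¹' D) hDXc hDX (hQX.union hDXc)
        (hDX.mono subset_union_right)
      refine ⟨range (fun x : f ⁻¹' t => f (e x)), ?_, ?_, ?_⟩
      · exact (hf.comp (e.isEmbedding.comp .subtypeVal)).isGδ_range
      · intro q hq
        obtain ⟨x, rfl⟩ := hQf hq
        obtain ⟨z, hz, rfl⟩ : x ∈ e '' (f ⁻¹' D) := he ▸ Or.inl hq
        exact ⟨⟨z, hDt hz⟩, rfl⟩
      · rintro _ ⟨x, rfl⟩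
        exact mem_range_self _
  have := hGδ.polishSpace
  exact hf.toHomeomorph.isClosedEmbedding.polishSpace

/-! ### Isolated points and points of local compactness -/

/-- A space is tame if its isolated points, and likewise its points of local compactness, form a
closed set. (Both sets are always open.) If such a space is zero-dimensional, each of its points
has a clopen neighborhood that is a point, a crowded compact space, or a nowhere locally compact
space. -/
def IsTame (X : Type*) [TopologicalSpace X] : Prop :=
  IsClosed {x : X | IsOpen {x}} ∧ IsClosed {x : X | ∃ K ∈ 𝓝 x, IsCompact K}

/-- The set `closure S \ S` is invariant and has dense complement: some countable dense set avoids
it, and if it is nonempty another one does not. -/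
theorem IsCDH.isClosed_of_invariant {X : Type*} [TopologicalSpace X] [SecondCountableTopology X]
    (h : IsCDH X) {S : Set X} (hinv : ∀ (e : X ≃ₜ X), ∀ x ∈ S, e x ∈ S) :
    IsClosed S := by
  have hd : Dense (closure S \ S)ᶜ := by
    refine dense_iff_inter_open.2 fun U hU ⟨x, hx⟩ => ?_
    by_cases hxS : x ∈ closure S
    · obtain ⟨y, hyU, hyS⟩ := mem_closure_iff.1 hxS U hU hx
      exact ⟨y, hyU, fun hy => hy.2 hyS⟩
    · exact ⟨x, hx, fun hx' => hxS hx'.1⟩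
  refine isClosed_of_closure_subset fun p hp => ?_
  by_contra hpS
  obtain ⟨A, hAs, hA, hAd⟩ := hd.exists_countable_dense_subset
  obtain ⟨e, he⟩ := h A (insert p A) hA hAd (hA.insert p) (hAd.mono (subset_insert p A))
  obtain ⟨a, ha, rfl⟩ : p ∈ e '' A := he ▸ mem_insert p A
  refine hAs ha ⟨?_, fun haS => hpS (hinv e a haS)⟩
  refine mem_closure_iff.2 fun U hU haU => ?_
  obtain ⟨y, hyU, hyS⟩ := mem_closure_iff.1 hp (e.symm ⁻¹' U) (hU.preimage e.symm.continuous)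
    (by simpa using haU)
  exact ⟨e.symm y, hyU, hinv e.symm y hyS⟩

theorem IsCDH.isTame {X : Type*} [TopologicalSpace X] [SecondCountableTopology X]
    (h : IsCDH X) : IsTame X := by
  constructor
  · refine h.isClosed_of_invariant fun e x hx => ?_
    have := e.isOpenMap _ hx
    rwa [image_singleton] at this
  · refine h.isClosed_of_invariant fun e x ⟨K, hKx, hK⟩ => ?_
    exact ⟨e '' K, e.isOpenMap.image_mem_nhds hKx, hK.image e.continuous⟩

section Pi

variable {I : Type*} {X : I → Type*} [∀ i, TopologicalSpace (X i)]

theorem exists_finite_image_eval_eq_univ {x : ∀ i, X i} {s : Set (∀ i, X i)} (hs : s ∈ 𝓝 x) :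
    {i | Function.eval i '' s ≠ univ}.Finite := by
  classical
  obtain ⟨U, hUs, hU, hx⟩ := mem_nhds_iff.1 hs
  obtain ⟨J, u, hu, hJU⟩ := isOpen_pi_iff.1 hU x hx
  refine J.finite_toSet.subset fun i hi => ?_
  by_contra hiJ
  refine hi (eq_univ_of_forall fun y => ⟨Function.update x i y, hUs (hJU fun j hj => ?_), ?_⟩)
  · rw [Function.update_of_ne (by rintro rfl; exact hiJ hj)]
    exact (hu j hj).2
  · simp

theorem isOpen_singleton_pi_iff (x : ∀ i, X i) :
    IsOpen {x} ↔ (∀ i, IsOpen {x i}) ∧ {i | ¬ Subsingleton (X i)}.Finite := by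
  constructor
  · intro h
    refine ⟨fun i => ?_, (exists_finite_image_eval_eq_univ (h.mem_nhds rfl)).subset fun i hi hu => ?_⟩
    · have := isOpenMap_eval i _ h
      rwa [image_singleton] at this
    · rw [image_singleton] at hu
      exact hi (subsingleton_univ_iff.1 (hu ▸ subsingleton_singleton))
  · rintro ⟨h, hfin⟩
    have : ({x} : Set (∀ i, X i)) = pi {i | ¬ Subsingleton (X i)} fun i => {x i} := by
      ext y
      refine ⟨fun hy i _ => congrFun hy i, fun hy => funext fun i => ?_⟩
      by_cases hi : Subsingleton (X i)
      · exact Subsingleton.elim _ _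
      · exact hy i hi
    rw [this]
    exact isOpen_set_pi hfin fun i _ => h i

theorem exists_isCompact_nhds_pi_iff (x : ∀ i, X i) :
    (∃ K ∈ 𝓝 x, IsCompact K) ↔
      (∀ i, ∃ K ∈ 𝓝 (x i), IsCompact K) ∧ {i | ¬ CompactSpace (X i)}.Finite := by
  classical
  constructor
  · rintro ⟨K, hKx, hK⟩
    refine ⟨fun i => ⟨_, (isOpenMap_eval i).image_mem_nhds hKx, hK.image (continuous_apply i)⟩,
      (exists_finite_image_eval_eq_univ hKx).subset fun i hi hu => hi ?_⟩
    exact ⟨hu ▸ hK.image (continuous_apply i)⟩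
  · rintro ⟨h, hfin⟩
    choose K hKx hK using h
    refine ⟨univ.pi fun i => if CompactSpace (X i) then univ else K i, ?_, ?_⟩
    · have : (univ.pi fun i => if CompactSpace (X i) then univ else K i) =
          pi {i | ¬ CompactSpace (X i)} K := by
        ext y
        simp only [mem_pi, mem_univ, true_implies, mem_ofPred_eq]
        refine forall_congr' fun i => ?_
        by_cases hi : CompactSpace (X i) <;> simp [hi]
      rw [this]
      exact set_pi_mem_nhds hfin fun i _ => hKx i
    · refine isCompact_univ_pi fun i => ?_
      split_ifs with hi
      · exact isCompact_univ
      · exact hK i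

theorem IsTame.pi (h : ∀ i, IsTame (X i)) : IsTame (∀ i, X i) := by
  constructor
  · simp only [isOpen_singleton_pi_iff]
    refine IsClosed.and ?_ isClosed_const
    rw [ofPred_forall]
    exact isClosed_iInter fun i => (h i).1.preimage (continuous_apply i)
  · simp only [exists_isCompact_nhds_pi_iff]
    refine IsClosed.and ?_ isClosed_const
    rw [ofPred_forall]
    exact isClosed_iInter fun i => (h i).2.preimage (continuous_apply i)

end Pi

/-! ### Zero-dimensional spaces -/

theorem IsZeroDimensional.exists_isClopen {X : Type*} [TopologicalSpace X]
    (h : IsZeroDimensional X) {x : X} {U : Set X} (hU : U ∈ 𝓝 x) :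
    ∃ V, IsClopen V ∧ x ∈ V ∧ V ⊆ U := by
  obtain ⟨V, hV, hx, hVU⟩ := h.mem_nhds_iff.1 hU
  exact ⟨V, hV, hx, hVU⟩

theorem isZeroDimensional_of_exists_isClopen {X : Type*} [TopologicalSpace X]
    (h : ∀ (x : X) (U : Set X), x ∈ U → IsOpen U → ∃ V, IsClopen V ∧ x ∈ V ∧ V ⊆ U) :
    IsZeroDimensional X :=
  isTopologicalBasis_of_isOpen_of_nhds (fun _ hV => hV.isOpen) h

theorem IsZeroDimensional.subtype {X : Type*} [TopologicalSpace X] (h : IsZeroDimensional X)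
    (s : Set X) : IsZeroDimensional s := by
  refine isZeroDimensional_of_exists_isClopen fun x U hx hU => ?_
  obtain ⟨U, hU', rfl⟩ := isOpen_induced_iff.1 hU
  obtain ⟨V, hV, hxV, hVU⟩ := h.exists_isClopen (hU'.mem_nhds hx)
  exact ⟨_, hV.preimage continuous_subtype_val, hxV, preimage_mono hVU⟩

theorem IsZeroDimensional.pi {I : Type*} {X : I → Type*} [∀ i, TopologicalSpace (X i)]
    (h : ∀ i, IsZeroDimensional (X i)) : IsZeroDimensional (∀ i, X i) := by
  refine isZeroDimensional_of_exists_isClopen fun x U hx hU => ?_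
  obtain ⟨J, u, hu, hJU⟩ := isOpen_pi_iff.1 hU x hx
  have : ∀ i, ∃ V, i ∈ J → IsClopen V ∧ x i ∈ V ∧ V ⊆ u i := by
    intro i
    by_cases hi : i ∈ J
    · obtain ⟨V, hV⟩ := (h i).exists_isClopen ((hu i hi).1.mem_nhds (hu i hi).2)
      exact ⟨V, fun _ => hV⟩
    · exact ⟨∅, fun hi' => (hi hi').elim⟩
  choose V hV using this
  refine ⟨(J : Set I).pi V, ⟨isClosed_set_pi fun i hi => (hV i hi).1.isClosed,
    isOpen_set_pi J.finite_toSet fun i hi => (hV i hi).1.isOpen⟩, fun i hi => (hV i hi).2.1, ?_⟩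
  exact (pi_mono fun i hi => (hV i hi).2.2).trans hJU

/-! ### Homeomorphisms with sequence spaces from clopen splittings -/

/-- If nested good sets shrink to points and every good set splits, at every stage `n`, into good
sets indexed by `ι` and satisfying `P n`, where the piece with index `i₀` can be made to contain a
given point, then the space is homeomorphic to `ℕ → ι`, with a given countable dense set `A`
corresponding to the sequences that are eventually equal to `i₀`. At every stage, the piece with
index `i₀` is made to contain the first element of `A`, in some enumeration, in the set that is
split. -/
theorem exists_homeomorph_of_splitting {X ι : Type*} [TopologicalSpace X] [T1Space X]
    [TopologicalSpace ι] [DiscreteTopology ι] (i₀ : ι) {A : Set X} (hA : A.Countable)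
    (hAd : Dense A) (good : Set X → Prop) (P : ℕ → Set X → Prop)
    (hopen : ∀ C, good C → IsOpen C) (hne : ∀ C, good C → C.Nonempty) (huniv : good univ)
    (hsplit : ∀ n C a, good C → a ∈ C → ∃ S : ι → Set X, (⋃ i, S i) = C ∧
      (∀ i j, i ≠ j → Disjoint (S i) (S j)) ∧ a ∈ S i₀ ∧ ∀ i, good (S i) ∧ P n (S i))
    (hbranch : ∀ K : ℕ → Set X, (∀ n, good (K n)) → Antitone K → (∀ n, P n (K (n + 1))) →
      ∃ p, (∀ n, p ∈ K n) ∧ ∀ U ∈ 𝓝 p, ∃ n, K n ⊆ U) :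
    ∃ e : X ≃ₜ (ℕ → ι), ∀ p, p ∈ A ↔ ∃ N, ∀ n ≥ N, e p n = i₀ := by
  classical
  obtain ⟨r, hr⟩ := countable_iff_exists_injOn.1 hA
  -- The first element of `A` in a good set.
  have hlead : ∀ C, ∃ a, good C → a ∈ A ∩ C ∧ ∀ b ∈ A ∩ C, r a ≤ r b := by
    intro C
    by_cases hC : good C
    · obtain ⟨x, hx⟩ := hAd.inter_open_nonempty C (hopen C hC) (hne C hC)
      have hwf := InvImage.wf r Nat.lt_wfRel.wf
      exact ⟨hwf.min (A ∩ C) ⟨x, hx.2, hx.1⟩, fun _ => ⟨hwf.min_mem _ _,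
        fun b hb => not_lt.1 (hwf.not_lt_min _ hb)⟩⟩
    · obtain ⟨x, -⟩ := hne univ huniv
      exact ⟨x, fun h => (hC h).elim⟩
  choose a ha using hlead
  have hsplit' : ∀ n C, ∃ S : ι → Set X, good C → (⋃ i, S i) = C ∧
      (∀ i j, i ≠ j → Disjoint (S i) (S j)) ∧ a C ∈ S i₀ ∧ ∀ i, good (S i) ∧ P n (S i) := by
    intro n C
    by_cases hC : good C
    · obtain ⟨S, hS⟩ := hsplit n C (a C) hC (ha C hC).1.2
      exact ⟨S, fun _ => hS⟩
    · exact ⟨fun _ => ∅, fun h => (hC h).elim⟩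
  choose S hS using hsplit'
  obtain ⟨C, hC_nil, hC_cons⟩ : ∃ C : List ι → Set X, C [] = univ ∧
      ∀ i l, C (i :: l) = S l.length (C l) i :=
    ⟨fun l => List.rec univ (fun i l D => S l.length D i) l, rfl, fun _ _ => rfl⟩
  have hgood : ∀ l, good (C l) := by
    intro l
    induction l with
    | nil => exact hC_nil ▸ huniv
    | cons i l ih => exact hC_cons i l ▸ ((hS l.length _ ih).2.2.2 i).1
  have hcover : ∀ l, (⋃ i, C (i :: l)) = C l := fun l => by
    simp only [hC_cons]
    exact (hS l.length _ (hgood l)).1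
  have hdisj : ∀ l i j q, q ∈ C (i :: l) → q ∈ C (j :: l) → i = j := by
    intro l i j q hi hj
    by_contra hij
    rw [hC_cons] at hi hj
    exact disjoint_left.1 ((hS l.length _ (hgood l)).2.1 i j hij) hi hj
  have hsub : ∀ i l, C (i :: l) ⊆ C l := fun i l => by
    rw [← hcover l]
    exact subset_iUnion (fun i => C (i :: l)) i
  have hres : ∀ (x : ℕ → ι) n, PiNat.res x (n + 1) = x n :: PiNat.res x n := fun x n => rfl
  have hanti : ∀ x : ℕ → ι, Antitone fun n => C (PiNat.res x n) := fun x =>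
    antitone_nat_of_succ_le fun n => hsub _ _
  have hbr : ∀ x : ℕ → ι, ∃ p, (∀ n, p ∈ C (PiNat.res x n)) ∧
      ∀ U ∈ 𝓝 p, ∃ n, C (PiNat.res x n) ⊆ U := by
    intro x
    refine hbranch _ (fun n => hgood _) (hanti x) fun n => ?_
    have := ((hS (PiNat.res x n).length _ (hgood (PiNat.res x n))).2.2.2 (x n)).2
    rw [PiNat.res_length] at this
    rwa [hres, hC_cons, PiNat.res_length]
  choose g hgC hgU using hbr
  have huniq : ∀ x q, (∀ n, q ∈ C (PiNat.res x n)) → g x = q := by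
    intro x q hq
    by_contra hgq
    obtain ⟨n, hn⟩ := hgU x {q}ᶜ (isOpen_compl_singleton.mem_nhds hgq)
    exact hn (hq n) rfl
  have hcoord : ∀ x y N, (∃ q, q ∈ C (PiNat.res x N) ∧ q ∈ C (PiNat.res y N)) →
      PiNat.res x N = PiNat.res y N := by
    intro x y N
    induction N with
    | zero => exact fun _ => rfl
    | succ n ih =>
      rintro ⟨q, hx, hy⟩
      have h := ih ⟨q, hsub _ _ hx, hsub _ _ hy⟩
      rw [hres] at hx hy
      rw [hres]
      rw [hres, ← h]
      rw [← h] at hy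
      rw [hdisj _ _ _ _ hx hy]
  have hinj : Function.Injective g := by
    intro x y hxy
    refine PiNat.res_injective (funext fun n => hcoord x y n ⟨g x, hgC x n, ?_⟩)
    rw [hxy]
    exact hgC y n
  have hsurj : Function.Surjective g := by
    intro q
    have hstep : ∀ l, ∃ i, q ∈ C l → q ∈ C (i :: l) := by
      intro l
      by_cases hq : q ∈ C l
      · obtain ⟨i, hi⟩ := mem_iUnion.1 ((hcover l).symm ▸ hq : q ∈ ⋃ i, C (i :: l))
        exact ⟨i, fun _ => hi⟩
      · exact ⟨i₀, fun h => (hq h).elim⟩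
    choose s hs using hstep
    let l : ℕ → List ι := fun n => Nat.rec [] (fun _ l => s l :: l) n
    have hl : ∀ n, PiNat.res (fun n => s (l n)) n = l n := by
      intro n
      induction n with
      | zero => rfl
      | succ n ih => rw [hres, ih]
    refine ⟨fun n => s (l n), huniq _ _ fun n => ?_⟩
    rw [hl]
    induction n with
    | zero => exact hC_nil ▸ mem_univ q
    | succ n ih => exact hs _ ih
  have hcont : Continuous g := by
    refine continuous_iff_continuousAt.2 fun x U hU => Filter.mem_map.2 ?_
    obtain ⟨n, hn⟩ := hgU x U hU
    have : PiNat.cylinder x n ∈ 𝓝 x :=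
      (PiNat.isOpen_cylinder _ x n).mem_nhds (PiNat.self_mem_cylinder x n)
    filter_upwards [this] with y hy
    refine hn ?_
    rw [PiNat.cylinder_eq_res] at hy
    rw [← show PiNat.res y n = PiNat.res x n from hy]
    exact hgC y n
  let e : (ℕ → ι) ≃ X := Equiv.ofBijective g ⟨hinj, hsurj⟩
  have heg : ∀ q, g (e.symm q) = q := e.apply_symm_apply
  have hsymm : Continuous e.symm := by
    refine continuous_pi fun n => continuous_discrete_rng.2 fun i => ?_
    refine isOpen_iff_mem_nhds.2 fun q hq => ?_
    have hqC : q ∈ C (PiNat.res (e.symm q) (n + 1)) := by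
      have := hgC (e.symm q) (n + 1)
      rwa [heg] at this
    filter_upwards [(hopen (C _) (hgood _)).mem_nhds hqC] with q' hq'
    have hq'C : q' ∈ C (PiNat.res (e.symm q') (n + 1)) := by
      have := hgC (e.symm q') (n + 1)
      rwa [heg] at this
    have := hcoord _ _ _ ⟨q', hq', hq'C⟩
    rw [hres, hres] at this
    exact (List.cons.inj this).1.symm.trans hq
  refine ⟨⟨e.symm, hsymm, hcont⟩, fun p => ?_⟩
  obtain ⟨x, rfl⟩ := hsurj p
  have hex : e.symm (g x) = x := e.symm_apply_apply x
  show g x ∈ A ↔ ∃ N, ∀ n ≥ N, e.symm (g x) n = i₀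
  rw [hex]
  let m : ℕ → X := fun n => a (C (PiNat.res x n))
  have hm : ∀ n, m n ∈ A ∩ C (PiNat.res x n) ∧ ∀ b ∈ A ∩ C (PiNat.res x n), r (m n) ≤ r b :=
    fun n => ha _ (hgood _)
  have hm₀ : ∀ n, m n ∈ C (i₀ :: PiNat.res x n) := fun n => by
    rw [hC_cons]
    exact (hS _ _ (hgood _)).2.2.1
  constructor
  · intro hx
    -- The ranks of the first elements increase along the branch and are bounded by that of `g x`.
    have hmono : Monotone fun n => r (m n) := monotone_nat_of_le_succ fun n =>
      (hm n).2 _ ⟨(hm (n + 1)).1.1, hsub _ _ (hm (n + 1)).1.2⟩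
    have hbdd : (range fun n => r (m n)).Finite := (finite_Iic (r (g x))).subset <| by
      rintro _ ⟨n, rfl⟩
      exact (hm n).2 _ ⟨hx, hgC x n⟩
    obtain ⟨_, ⟨N, rfl⟩, hN⟩ := hbdd.exists_maximal (range_nonempty _)
    refine ⟨N, fun n hn => ?_⟩
    have h1 : r (m n) = r (m (n + 1)) := by
      refine le_antisymm (hmono n.le_succ) ?_
      have := hN (mem_range_self (n + 1)) (hmono (hn.trans n.le_succ))
      exact this.trans (hmono hn)
    have h2 : m n = m (n + 1) := hr (hm n).1.1 (hm (n + 1)).1.1 h1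
    refine hdisj (PiNat.res x n) _ _ (m n) ?_ (hm₀ n)
    rw [h2]
    exact (hm (n + 1)).1.2
  · rintro ⟨N, hN⟩
    have hmem : ∀ k, m N ∈ C (PiNat.res x (N + k)) := by
      intro k
      induction k with
      | zero => exact (hm N).1.2
      | succ k ih =>
        have h1 : m (N + k) = m N := by
          refine hr (hm (N + k)).1.1 (hm N).1.1 (le_antisymm ((hm _).2 _ ⟨(hm N).1.1, ih⟩) ?_)
          exact (hm N).2 _ ⟨(hm (N + k)).1.1, hanti x (Nat.le_add_right N k) (hm (N + k)).1.2⟩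
        have h2 := hm₀ (N + k)
        rw [h1] at h2
        rw [← add_assoc, hres, hN _ (Nat.le_add_right N k)]
        exact h2
    rw [huniq x (m N) fun n => hanti x (Nat.le_add_left n N) (hmem n)]
    exact (hm N).1.1

theorem isCDH_of_forall_exists_homeomorph {X Z : Type*} [TopologicalSpace X] [TopologicalSpace Z]
    (E : Set Z) (h : ∀ A : Set X, A.Countable → Dense A → ∃ e : X ≃ₜ Z, ∀ p, p ∈ A ↔ e p ∈ E) :
    IsCDH X := by
  intro A B hA hAd hB hBd
  obtain ⟨e, he⟩ := h A hA hAd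
  obtain ⟨f, hf⟩ := h B hB hBd
  refine ⟨e.trans f.symm, ?_⟩
  rw [Homeomorph.image_eq_preimage_symm]
  ext x
  simp [he, hf]

theorem isCDH_of_subsingleton {X : Type*} [TopologicalSpace X] [Subsingleton X] : IsCDH X := by
  intro A B _ hA _ hB
  rw [dense_discrete.1 hA, dense_discrete.1 hB]
  exact ⟨Homeomorph.refl X, by simp⟩

/-! ### Locally compact, nowhere locally compact, and glued pieces -/

/-- A crowded compact zero-dimensional space is homeomorphic to the Cantor set, with a given
countable dense set corresponding to the sequences that are eventually `false`. -/
theorem isCDH_of_compactSpace {X : Type*} [TopologicalSpace X] [T1Space X] [CompactSpace X]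
    [SecondCountableTopology X] (hz : IsZeroDimensional X) (hi : ∀ x : X, ¬ IsOpen {x}) :
    IsCDH X := by
  rcases isEmpty_or_nonempty X with hX | hX
  · exact isCDH_of_subsingleton
  obtain ⟨b, hbsub, hbc, hb⟩ := hz.exists_countable
  have hbne : b.Nonempty := by
    obtain ⟨x⟩ := hX
    obtain ⟨V, hV, -⟩ := hb.exists_subset_of_mem_open (mem_univ x) isOpen_univ
    exact ⟨V, hV⟩
  obtain ⟨V, rfl⟩ := hbc.exists_eq_range hbne
  have hV : ∀ n, IsClopen (V n) := fun n => hbsub (mem_range_self n)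
  refine isCDH_of_forall_exists_homeomorph {z : ℕ → Bool | ∃ N, ∀ n ≥ N, z n = false}
    fun A hA hAd => exists_homeomorph_of_splitting false hA hAd
      (fun C => IsClopen C ∧ C.Nonempty) (fun n C => C ⊆ V n ∨ Disjoint C (V n))
      (fun C hC => hC.1.isOpen) (fun C hC => hC.2) ⟨isClopen_univ, univ_nonempty⟩ ?_ ?_
  · rintro n C a ⟨hC, -⟩ ha
    -- Split along `V n` if this set cuts `C`, and arbitrarily otherwise.
    obtain ⟨W, hW, haW, hne, hP⟩ : ∃ W, IsClopen W ∧ a ∈ W ∧ (C \ W).Nonempty ∧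
        ((C ∩ W ⊆ V n ∨ Disjoint (C ∩ W) (V n)) ∧ (C \ W ⊆ V n ∨ Disjoint (C \ W) (V n))) := by
      by_cases hcut : (C ∩ V n).Nonempty ∧ (C \ V n).Nonempty
      · by_cases haV : a ∈ V n
        · exact ⟨V n, hV n, haV, hcut.2, Or.inl inter_subset_right, Or.inr disjoint_sdiff_left⟩
        · refine ⟨(V n)ᶜ, (hV n).compl, haV, ?_, Or.inr ?_, Or.inl ?_⟩
          · rw [sdiff_eq, compl_compl]
            exact hcut.1
          · exact disjoint_compl_left.mono_left inter_subset_right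
          · rw [sdiff_eq, compl_compl]
            exact inter_subset_right
      · have hCV : C ⊆ V n ∨ Disjoint C (V n) := by
          rw [not_and_or, not_nonempty_iff_eq_empty, not_nonempty_iff_eq_empty,
            ← disjoint_iff_inter_eq_empty, sdiff_eq_empty] at hcut
          exact hcut.symm
        obtain ⟨b, hbC, hba⟩ : ∃ b ∈ C, b ≠ a := by
          by_contra! hCa
          have hCe : C = {a} := Subset.antisymm hCa (singleton_subset_iff.2 ha)
          exact hi a (hCe ▸ hC.isOpen)
        obtain ⟨W, hW, haW, hWb⟩ := hz.exists_isClopen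
          (isOpen_compl_singleton.mem_nhds (show a ∈ ({b}ᶜ : Set X) from hba.symm))
        exact ⟨W, hW, haW, ⟨b, hbC, fun hbW => hWb hbW rfl⟩,
          hCV.imp inter_subset_left.trans (·.mono_left inter_subset_left),
          hCV.imp sdiff_subset.trans (·.mono_left sdiff_subset)⟩
    refine ⟨fun i => bif i then C \ W else C ∩ W, ?_, ?_, ⟨ha, haW⟩, ?_⟩
    · ext x
      simp only [mem_iUnion, Bool.exists_bool, cond_false, cond_true, mem_inter_iff, mem_sdiff]
      tauto
    · have hd : Disjoint (C ∩ W) (C \ W) := disjoint_sdiff_right.mono_left inter_subset_right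
      rintro (_ | _) (_ | _) hij
      · exact (hij rfl).elim
      · exact hd
      · exact hd.symm
      · exact (hij rfl).elim
    · rintro (_ | _)
      · exact ⟨⟨hC.inter hW, a, ha, haW⟩, hP.1⟩
      · exact ⟨⟨hC.diff hW, hne⟩, hP.2⟩
  · intro K hK hanti hKP
    obtain ⟨p, hp⟩ := IsCompact.nonempty_iInter_of_sequence_nonempty_isCompact_isClosed K
      (fun n => hanti n.le_succ) (fun n => (hK n).2) (hK 0).1.isClosed.isCompact
      (fun n => (hK n).1.isClosed)
    rw [mem_iInter] at hp
    refine ⟨p, hp, fun U hU => ?_⟩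
    obtain ⟨_, ⟨n, rfl⟩, hpV, hVU⟩ := hb.mem_nhds_iff.1 hU
    refine ⟨n + 1, ?_⟩
    rcases hKP n with h | h
    · exact h.trans hVU
    · exact (disjoint_left.1 h (hp (n + 1)) hpV).elim

theorem IsClopen.disjointed {X : Type*} [TopologicalSpace X] {w : ℕ → Set X}
    (hw : ∀ n, IsClopen (w n)) (n : ℕ) : IsClopen (disjointed w n) :=
  disjointedRec (fun _ _ ht => ht.diff (hw _)) (hw n)

/-- A clopen set that is not compact has an infinite partition into small clopen pieces, obtained
from a countable clopen cover without a finite subcover. -/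
theorem exists_partition_of_not_isCompact {X : Type*} [MetricSpace X]
    [SecondCountableTopology X] (hz : IsZeroDimensional X) {C : Set X} (hC : IsClopen C)
    (hnc : ¬ IsCompact C) {a : X} (ha : a ∈ C) {ε : ℝ} (hε : 0 < ε) :
    ∃ S : ℕ → Set X, (⋃ i, S i) = C ∧ (∀ i j, i ≠ j → Disjoint (S i) (S j)) ∧ a ∈ S 0 ∧
      ∀ i, (IsClopen (S i) ∧ (S i).Nonempty) ∧ ∀ x ∈ S i, ∀ y ∈ S i, dist x y ≤ ε := by
  classical
  rw [isCompact_iff_finite_subcover] at hnc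
  push Not at hnc
  obtain ⟨ι, U, hU, hCU, hfin⟩ := hnc
  have hW : ∀ x : C, ∃ W, IsClopen W ∧ (x : X) ∈ W ∧ W ⊆ C ∩ Metric.ball (x : X) (ε / 2) ∧
      ∃ i, W ⊆ U i := by
    intro x
    obtain ⟨i, hi⟩ := mem_iUnion.1 (hCU x.2)
    obtain ⟨W, hW, hxW, hWs⟩ := hz.exists_isClopen (Filter.inter_mem (Filter.inter_mem
      (hC.isOpen.mem_nhds x.2) (Metric.ball_mem_nhds (x : X) (half_pos hε)))
      ((hU i).mem_nhds hi))
    exact ⟨W, hW, hxW, hWs.trans inter_subset_left, i, hWs.trans inter_subset_right⟩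
  choose W hWc hxW hWs i hWi using hW
  obtain ⟨T, hT, hTU⟩ := isOpen_iUnion_countable W fun x => (hWc x).isOpen
  have hTC : ⋃ x ∈ T, W x = C := by
    rw [hTU]
    exact Subset.antisymm (iUnion_subset fun x => (hWs x).trans inter_subset_left)
      fun x hx => mem_iUnion.2 ⟨⟨x, hx⟩, hxW _⟩
  have hTne : T.Nonempty := by
    rw [← hTC] at ha
    obtain ⟨x, hx, -⟩ := mem_iUnion₂.1 ha
    exact ⟨x, hx⟩
  obtain ⟨t, rfl⟩ := hT.exists_eq_range hTne
  rw [biUnion_range] at hTC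
  let D : ℕ → Set X := disjointed fun n => W (t n)
  have hDU : ⋃ n, D n = C := by rw [← hTC]; exact iUnion_disjointed
  have hDW : ∀ n, D n ⊆ W (t n) := fun n => disjointed_subset _ n
  let N : Set ℕ := {n | (D n).Nonempty}
  have hN : N.Infinite := by
    intro hNfin
    refine hfin (hNfin.toFinset.image fun n => i (t n)) fun x hx => ?_
    rw [← hDU] at hx
    obtain ⟨n, hn⟩ := mem_iUnion.1 hx
    refine mem_iUnion₂.2 ⟨i (t n), ?_, hWi _ (hDW n hn)⟩
    exact Finset.mem_image_of_mem _ (hNfin.mem_toFinset.2 ⟨x, hn⟩)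
  have hNi : Infinite N := hN.to_subtype
  obtain ⟨e₀⟩ : Nonempty (ℕ ≃ N) := ⟨(Nat.Subtype.orderIsoOfNat N).toEquiv⟩
  obtain ⟨n₀, hn₀⟩ := mem_iUnion.1 (hDU.symm ▸ ha : a ∈ ⋃ n, D n)
  let m₀ : N := ⟨n₀, a, hn₀⟩
  let e : ℕ ≃ N := (Equiv.swap 0 (e₀.symm m₀)).trans e₀
  have he : e 0 = m₀ := by simp [e]
  refine ⟨fun k => D (e k), ?_, ?_, ?_, fun k => ⟨⟨IsClopen.disjointed (fun n => hWc (t n)) _,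
    (e k).2⟩, fun x hx y hy => ?_⟩⟩
  · rw [← hDU]
    refine Subset.antisymm (iUnion_subset fun k => subset_iUnion D _) fun x hx => ?_
    obtain ⟨n, hn⟩ := mem_iUnion.1 hx
    exact mem_iUnion.2 ⟨e.symm ⟨n, x, hn⟩, by simpa using hn⟩
  · intro k l hkl
    exact disjoint_disjointed _ fun h => hkl (e.injective (Subtype.ext h))
  · show a ∈ D (e 0)
    rwa [he]
  · have hx' := Metric.mem_ball.1 ((hWs _ (hDW _ hx)).2)
    have hy' := Metric.mem_ball.1 ((hWs _ (hDW _ hy)).2)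
    have := dist_triangle_right x y (t (e k) : X)
    linarith

/-- A zero-dimensional Polish space without nonempty compact open sets is homeomorphic to the Baire
space, with a given countable dense set corresponding to the sequences that are eventually `0`. -/
theorem isCDH_of_forall_not_isCompact {X : Type*} [TopologicalSpace X] [PolishSpace X]
    (hz : IsZeroDimensional X) (hX : ∀ C : Set X, IsClopen C → C.Nonempty → ¬ IsCompact C) :
    IsCDH X := by
  rcases isEmpty_or_nonempty X with hX | hne
  · exact isCDH_of_subsingleton
  let := upgradeIsCompletelyMetrizable X
  refine isCDH_of_forall_exists_homeomorph {z : ℕ → ℕ | ∃ N, ∀ n ≥ N, z n = 0}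
    fun A hA hAd => exists_homeomorph_of_splitting 0 hA hAd
      (fun C => IsClopen C ∧ C.Nonempty)
      (fun n C => ∀ x ∈ C, ∀ y ∈ C, dist x y ≤ 1 / (n + 1 : ℝ))
      (fun C hC => hC.1.isOpen) (fun C hC => hC.2) ⟨isClopen_univ, univ_nonempty⟩ ?_ ?_
  · rintro n C a ⟨hC, hCne⟩ ha
    exact exists_partition_of_not_isCompact hz hC (hX C hC hCne) ha Nat.one_div_pos_of_nat
  · intro K hK hanti hKP
    choose z hzK using fun n => (hK (n + 1)).2
    have hcau : CauchySeq z := cauchySeq_of_le_tendsto_0 (fun n : ℕ => 1 / (n + 1 : ℝ))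
      (fun n m N hn hm => hKP N _ (hanti (Nat.succ_le_succ hn) (hzK n)) _
        (hanti (Nat.succ_le_succ hm) (hzK m))) tendsto_one_div_add_atTop_nhds_zero_nat
    obtain ⟨p, hp⟩ := cauchySeq_tendsto_of_complete hcau
    have hpK : ∀ n, p ∈ K n := fun n => (hK n).1.isClosed.mem_of_tendsto hp <| by
      filter_upwards [Filter.eventually_ge_atTop n] with m hm
      exact hanti (hm.trans m.le_succ) (hzK m)
    refine ⟨p, hpK, fun U hU => ?_⟩
    obtain ⟨ε, hε, hεU⟩ := Metric.mem_nhds_iff.1 hU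
    obtain ⟨n, hn⟩ := exists_nat_one_div_lt hε
    exact ⟨n + 1, fun x hx => hεU ((hKP n x hx p (hpK _)).trans_lt hn)⟩

/-- Countable dense homogeneity is glued from the pieces of a partition into clopen sets. -/
theorem isCDH_of_forall_exists_isClopen {X : Type*} [TopologicalSpace X]
    [SecondCountableTopology X]
    (h : ∀ x : X, ∃ U, IsClopen U ∧ x ∈ U ∧ ∀ V ⊆ U, IsClopen V → IsCDH V) : IsCDH X := by
  rcases isEmpty_or_nonempty X with hX | hX
  · exact isCDH_of_subsingleton
  choose U hU hxU hUV using h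
  obtain ⟨T, hT, hTU⟩ := isOpen_iUnion_countable U fun x => (hU x).isOpen
  have hcov : ⋃ x ∈ T, U x = univ :=
    hTU.trans (eq_univ_of_forall fun x => mem_iUnion.2 ⟨x, hxU x⟩)
  have hTne : T.Nonempty := by
    obtain ⟨x⟩ := hX
    obtain ⟨y, hy, -⟩ := mem_iUnion₂.1 (hcov.symm ▸ mem_univ x : x ∈ ⋃ x ∈ T, U x)
    exact ⟨y, hy⟩
  obtain ⟨t, rfl⟩ := hT.exists_eq_range hTne
  rw [biUnion_range] at hcov
  let D : ℕ → Set X := disjointed fun n => U (t n)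
  have hDU : ⋃ n, D n = univ := by rw [← hcov]; exact iUnion_disjointed
  have hDc : ∀ n, IsClopen (D n) := IsClopen.disjointed fun n => hU (t n)
  have hDcdh : ∀ n, IsCDH (D n) := fun n => hUV (t n) _ (disjointed_subset _ n) (hDc n)
  let φ : (Σ n, D n) → X := fun z => z.2
  have hφ : IsHomeomorph φ := by
    refine ⟨continuous_sigma fun n => continuous_subtype_val,
      isOpenMap_sigma.2 fun n => (hDc n).isOpen.isOpenMap_subtype_val, ?_, fun x => ?_⟩
    · rintro ⟨n, x, hx⟩ ⟨m, y, hy⟩ (rfl : x = y)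
      obtain rfl : n = m := by
        by_contra hnm
        exact disjoint_left.1 (disjoint_disjointed (fun n => U (t n)) hnm) hx hy
      rfl
    · obtain ⟨n, hn⟩ := mem_iUnion.1 (hDU.symm ▸ mem_univ x : x ∈ ⋃ n, D n)
      exact ⟨⟨n, x, hn⟩, rfl⟩
  intro A B hA hAd hB hBd
  have htr : ∀ (A : Set X) n, A.Countable → Dense A →
      ((↑) ⁻¹' A : Set (D n)).Countable ∧ Dense ((↑) ⁻¹' A : Set (D n)) := fun A n hA hAd =>
    ⟨hA.preimage_of_injOn Subtype.val_injective.injOn,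
      hAd.preimage (hDc n).isOpen.isOpenMap_subtype_val⟩
  choose e he using fun n => hDcdh n _ _ (htr A n hA hAd).1 (htr A n hA hAd).2
    (htr B n hB hBd).1 (htr B n hB hBd).2
  have hψ : IsHomeomorph (Sigma.map id fun n => e n : (Σ n, D n) → Σ n, D n) := by
    refine ⟨continuous_sigma fun n => continuous_sigmaMk.comp (e n).continuous,
      isOpenMap_sigma.2 fun n => isOpenMap_sigmaMk.comp (e n).isOpenMap, ?_, ?_⟩
    · exact Function.injective_id.sigma_map fun n => (e n).injective
    · exact Function.surjective_id.sigma_map fun n => (e n).surjective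
  let Φ := hφ.homeomorph
  refine ⟨(Φ.symm.trans hψ.homeomorph).trans Φ, ?_⟩
  have key : ∀ x, x ∈ A ↔ ((Φ.symm.trans hψ.homeomorph).trans Φ) x ∈ B := by
    intro x
    obtain ⟨⟨n, d⟩, rfl⟩ := Φ.surjective x
    have h1 : ((Φ.symm.trans hψ.homeomorph).trans Φ) (Φ ⟨n, d⟩) = (e n d : X) := by
      simp only [Homeomorph.trans_apply, Homeomorph.symm_apply_apply]
      rfl
    have h2 : (e n d : X) ∈ B ↔ e n d ∈ e n '' ((↑) ⁻¹' A) := by rw [he]; rfl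
    rw [h1, h2, (e n).injective.mem_set_image]
    rfl
  ext y
  constructor
  · rintro ⟨x, hx, rfl⟩
    exact (key x).1 hx
  · intro hy
    obtain ⟨x, rfl⟩ := ((Φ.symm.trans hψ.homeomorph).trans Φ).surjective y
    exact ⟨x, (key x).2 hy, rfl⟩

/-! ### Tame Polish spaces and their products -/

/-- Every point has a clopen neighborhood all of whose clopen subsets are points, crowded and
compact, or without compact open subsets; such sets are countable dense homogeneous. -/
theorem IsTame.isCDH {X : Type*} [TopologicalSpace X] [PolishSpace X]
    (hz : IsZeroDimensional X) (h : IsTame X) : IsCDH X := by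
  refine isCDH_of_forall_exists_isClopen fun x => ?_
  by_cases hxi : IsOpen {x}
  · refine ⟨{x}, ⟨isClosed_singleton, hxi⟩, rfl, fun V hV _ => ?_⟩
    have : Subsingleton V := (subsingleton_singleton.anti hV).coe_sort
    exact isCDH_of_subsingleton
  have isOpen_singleton_val : ∀ {V : Set X} (_ : IsClopen V) (v : V), IsOpen {v} →
      IsOpen {(v : X)} := by
    intro V hV v hv
    have := hV.isOpen.isOpenMap_subtype_val _ hv
    rwa [image_singleton] at this
  by_cases hxK : ∃ K ∈ 𝓝 x, IsCompact K
  · obtain ⟨K, hKx, hK⟩ := hxK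
    obtain ⟨U, hU, hxU, hUs⟩ := hz.exists_isClopen
      (Filter.inter_mem hKx (h.1.isOpen_compl.mem_nhds hxi))
    refine ⟨U, hU, hxU, fun V hV hVc => ?_⟩
    have : CompactSpace V := isCompact_iff_compactSpace.1
      (hK.of_isClosed_subset hVc.isClosed fun v hv => (hUs (hV hv)).1)
    exact isCDH_of_compactSpace (hz.subtype V) fun v hv =>
      (hUs (hV v.2)).2 (isOpen_singleton_val hVc v hv)
  · obtain ⟨U, hU, hxU, hUs⟩ := hz.exists_isClopen (h.2.isOpen_compl.mem_nhds hxK)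
    refine ⟨U, hU, hxU, fun V hV hVc => ?_⟩
    have := hVc.isClosed.polishSpace
    refine isCDH_of_forall_not_isCompact (hz.subtype V) fun C hC ⟨v, hv⟩ hCc => ?_
    exact hUs (hV v.2) ⟨_, (hVc.isOpen.isOpenMap_subtype_val).image_mem_nhds
      (hC.isOpen.mem_nhds hv), hCc.image continuous_subtype_val⟩

theorem corollary1p3 {I : Type*} [Countable I] (X : I → Type*)
    [∀ i, TopologicalSpace (X i)] [∀ i, SeparableSpace (X i)] [∀ i, MetrizableSpace (X i)]
    (hzero : ∀ i, IsZeroDimensional (X i))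
    (hborel : ∀ i, IsAbsoluteBorel (X i))
    (hcdh : ∀ i, IsCDH (X i)) :
    IsCDH (∀ i, X i) := by
  have hP : ∀ i, PolishSpace (X i) := fun i => (hcdh i).polishSpace (hborel i)
  exact (IsTame.pi fun i => (hcdh i).isTame).isCDH (.pi hzero)
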